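/- Let $M=\mathbb S^3\times\mathbb S^1$ with the product of the round metrics, and let $\mathrm{Diff}(M)$ be the group of $C^\infty$ diffeomorphisms of $M$. For a finite set $S$ let $\Sigma=S^{\mathbb Z}$ be the two-sided full shift with $\sigma(x)_i=x_{i+1}$. A map $\mathcal A:\Sigma\to\mathrm{Diff}(M)$ defines the skew product $F(x,p)=(\sigma x,\mathcal A(x)p)$ on $\Sigma\times M$. Write $D_{\rm fib}F^n(x,p)$ for the derivative at $p$ of $\mathcal A(\sigma^{n-1}x)\circ\cdots\circ\mathcal A(x)$. The fiber Lyapunov exponent of a nonzero $v\in T_pM$ at $(x,p)$ is $\lim_{n\to\infty}\frac1n\log\|D_{\rm fib}F^n(x,p)v\|$. The top fiber Lyapunov exponent of an $F$-invariant probability measure $\mu$ is $\lim_{n\to\infty}\frac1n\int\log\|D_{\rm fib}F^n\|\,d\mu$. **Theorem.** There exist a finite set $S$ and a locally constant map $\mathcal A:\Sigma=S^{\mathbb Z}\to\mathrm{Diff}(M)$ such that 1. $F$ preserves a Borel probability measure $\mu$ on $\Sigma\times M$ whose top fiber Lyapunov exponent is nonzero; 2. every $F$-invariant Borel probability measure $\nu$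 on $\Sigma\times M$ supported over a periodic orbit of $\sigma$ (that is, $\nu(\mathcal O\times M)=1$ for the orbit $\mathcal O$ of some $\sigma$-periodic point) has all fiber Lyapunov exponents equal to zero: for $\nu$-almost every $(x,p)$, every nonzero $v\in T_pM$ has fiber Lyapunov exponent $0$ at $(x,p)$, and the top fiber Lyapunov exponent of $\nu$ is $0$. (The existence of the limits, and the integrability of $\log\|D_{\rm fib}F^n\|$ for every $n$, is part of the assertions.) -/

import Mathlib

open scoped Manifold ContDiff Topology
open MeasureTheory Filter

noncomputable section

namespace FiberLyapunov

/-- The unit sphere `S^n` in `ℝ^(n+1)`, with Mathlib's smooth structure. -/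
abbrev Sph (n : ℕ) : Type := Metric.sphere (0 : EuclideanSpace ℝ (Fin (n + 1))) 1

/-- The closed 4-manifold `S^3 × S^1`. -/
abbrev M : Type := Sph 3 × Sph 1

/-- The model with corners of `S^3 × S^1` (without boundary, of dimension `3 + 1`). -/
abbrev IM : ModelWithCorners ℝ (EuclideanSpace ℝ (Fin 3) × EuclideanSpace ℝ (Fin 1))
    (ModelProd (EuclideanSpace ℝ (Fin 3)) (EuclideanSpace ℝ (Fin 1))) :=
  (𝓡 3).prod (𝓡 1)

/-- `Diff(M)`: the smooth diffeomorphisms of `S^3 × S^1`. -/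
abbrev DiffM : Type := Diffeomorph IM IM M M ∞

/-- The length of a tangent vector of `S^3 × S^1` in the product of the round metrics, that is, in
the Riemannian metric induced by the inclusion into `ℝ^4 × ℝ^2`. -/
def tangentNorm (p : M) (v : TangentSpace IM p) : ℝ :=
  Real.sqrt
    (‖mvfderiv IM (fun q : M => (q.1 : EuclideanSpace ℝ (Fin 4))) p v‖ ^ 2 +
      ‖mvfderiv IM (fun q : M => (q.2 : EuclideanSpace ℝ (Fin 2))) p v‖ ^ 2)

/-- The two-sided full shift space on `k` symbols, with the product topology. -/
abbrev FullShift (k : ℕ) : Type := ℤ → Fin k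

variable {k : ℕ}

/-- The (left) shift map. -/
def shift (x : FullShift k) : FullShift k := fun i => x (i + 1)

/-- The skew product (suspension) `F(x, p) = (σ x, A(x) p)` of a cocycle `A`. -/
def skewProduct (A : FullShift k → DiffM) (z : FullShift k × M) : FullShift k × M :=
  (shift z.1, A z.1 z.2)

/-- The iterated cocycle `A(σ^(n-1) x) ∘ ⋯ ∘ A(σ x) ∘ A(x)`: the map of the fiber over `x` to the
fiber over `σ^n x` given by the `n`-th iterate of the skew product. -/
def fiberIterate (A : FullShift k → DiffM) (n : ℕ) (x : FullShift k) (p : M) : M :=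
  ((skewProduct A)^[n] (x, p)).2

/-- The fiber derivative at `z = (x, p)` of the `n`-th iterate of the skew product. -/
def fiberDeriv (A : FullShift k → DiffM) (n : ℕ) (z : FullShift k × M) :
    TangentSpace IM z.2 →L[ℝ] TangentSpace IM (fiberIterate A n z.1 z.2) :=
  mfderiv IM IM (fiberIterate A n z.1) z.2

/-- The operator norm of the fiber derivative. -/
def fiberDerivNorm (A : FullShift k → DiffM) (n : ℕ) (z : FullShift k × M) : ℝ :=
  sSup {r : ℝ | ∃ v : TangentSpace IM z.2, tangentNorm z.2 v ≤ 1 ∧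
    r = tangentNorm (fiberIterate A n z.1 z.2) (fiberDeriv A n z v)}

/-- `c` is the top fiber Lyapunov exponent of the invariant probability measure `μ`:
`c = lim (1/n) ∫ log ‖D_fib F^n‖ dμ`. -/
def HasTopFiberExponent (A : FullShift k → DiffM) (μ : Measure (FullShift k × M)) (c : ℝ) : Prop :=
  (∀ n : ℕ, Integrable (fun z => Real.log (fiberDerivNorm A n z)) μ) ∧
    Tendsto (fun n : ℕ => (1 / (n : ℝ)) * ∫ z, Real.log (fiberDerivNorm A n z) ∂μ) atTop (𝓝 c)

/-- `c` is the fiber Lyapunov exponent at `z = (x, p)` of the tangent vector `v` of the fiber: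
`c = lim (1/n) log ‖D_fib F^n v‖`. -/
def HasFiberExponentAt (A : FullShift k → DiffM) (z : FullShift k × M) (v : TangentSpace IM z.2)
    (c : ℝ) : Prop :=
  Tendsto (fun n : ℕ => (1 / (n : ℝ)) *
    Real.log (tangentNorm (fiberIterate A n z.1 z.2) (fiberDeriv A n z v))) atTop (𝓝 c)

/-- All fiber Lyapunov exponents of `ν` are zero: at almost every point every nonzero tangent vector
of the fiber has exponent zero, and the top fiber exponent of `ν` is zero. -/
def AllFiberExponentsZero (A : FullShift k → DiffM) (ν : Measure (FullShift k × M)) : Prop :=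
  (∀ᵐ z ∂ν, ∀ v : TangentSpace IM z.2, v ≠ 0 → HasFiberExponentAt A z v 0) ∧
    HasTopFiberExponent A ν 0

/-- The measure `ν` is supported over the orbit of some periodic point of the shift. -/
def SupportedOverPeriodicOrbit (ν : Measure (FullShift k × M)) : Prop :=
  ∃ x : FullShift k, x ∈ Function.periodicPts (shift (k := k)) ∧
    ∀ᵐ z ∂ν, ∃ j : ℕ, z.1 = (shift (k := k))^[j] x

end FiberLyapunov

end

noncomputable section

namespace FiberLyapunov

/-! The fiber maps are $f_{c,u}(p,q)=(D_{\mathrm{Re}(cq)}p,\,uq)$, where $q\in\mathbb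
S^1\subset\mathbb C$ and $D_t$ is the flow on $\mathbb S^3$ induced by the linear dilation fixing a
pole and scaling its orthogonal complement by $e^t$. Since $D$ is a flow, $f_{c',u'}\circ
f_{c,u}=f_{c+c'u,\,u'u}$: the family is closed under composition, and an iterate is controlled by a
single complex number. Take $u=\rho=e^{i}$ and $c=\pm1$ according to the symbol at $0$. Then the
$n$-th iterate over $x$ is $f_{c_n,\rho^n}$ with drift $c_n=\sum_{j<n}\pm\rho^j$.

If $x$ has period $m$, then $c_{n+m}=c_m+\rho^m c_n$. As $\pi$ is irrational, $\rho^m\ne1$, so this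
is a rotation of the plane about a fixed point and the drift is bounded
(`norm_drift_le_of_isPeriodicPt`). All iterates then lie in a compact family of diffeomorphisms,
their derivatives are uniformly bi-Lipschitz (`exists_imageNorm_modelMap_bounds`), and every
exponent is zero.

A nonperiodic sequence can resonate with the rotation. Let the $j$-th sign be that of
$\mathrm{Re}(\rho^jw)$. Over the pole, at circle coordinate $w$, the dilation times then add up to
$\sum_{j<n}|\mathrm{Re}(\rho^jw)|$, which is exactly $\log\|D_{\rm fib}F^n\|$
(`log_fiberDerivNorm_codedPoint`). Pushing Haar measure forward under this coding gives an invariant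
measure with top exponent $\int|\mathrm{Re}\,w|>0$. -/

/-- The ambient space `ℝ^4 × ℝ^2` of `S^3 × S^1`. -/
abbrev Ambient : Type := EuclideanSpace ℝ (Fin 4) × EuclideanSpace ℝ (Fin 2)

/-- The isometry of the complex plane with `ℝ^2`. -/
def planeIso : ℂ ≃ₗᵢ[ℝ] EuclideanSpace ℝ (Fin 2) := Complex.orthonormalBasisOneI.repr

/-! ### Dilations and the ambient model maps -/

/-- The pole of `S^3` fixed by the dilations. -/
def pole : EuclideanSpace ℝ (Fin 4) := EuclideanSpace.single 0 1

/-- The linear map of `ℝ^4` that fixes the pole and is multiplication by `e^t` on its orthogonal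
complement. -/
def dilation (t : ℝ) (p : EuclideanSpace ℝ (Fin 4)) : EuclideanSpace ℝ (Fin 4) :=
  Real.exp t • p + ((1 - Real.exp t) * p 0) • pole

@[simp] lemma pole_apply_zero : pole 0 = 1 := by simp [pole]

@[simp] lemma norm_pole : ‖pole‖ = 1 := by simp [pole]

lemma inner_pole_left (a : EuclideanSpace ℝ (Fin 4)) : inner ℝ pole a = a 0 := by
  simp [pole, EuclideanSpace.inner_single_left]

@[simp] lemma dilation_apply_zero (t : ℝ) (p : EuclideanSpace ℝ (Fin 4)) :
    dilation t p 0 = p 0 := by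
  simp [dilation]; ring

lemma dilation_dilation (s t : ℝ) (p : EuclideanSpace ℝ (Fin 4)) :
    dilation s (dilation t p) = dilation (s + t) p := by
  rw [dilation, dilation_apply_zero, dilation, dilation, Real.exp_add]
  module

@[simp] lemma dilation_zero (p : EuclideanSpace ℝ (Fin 4)) : dilation 0 p = p := by
  simp [dilation]

lemma dilation_smul (t r : ℝ) (p : EuclideanSpace ℝ (Fin 4)) :
    dilation t (r • p) = r • dilation t p := by
  simp only [dilation, PiLp.smul_apply, smul_eq_mul]
  module

@[simp] lemma dilation_pole (t : ℝ) : dilation t pole = pole := by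
  simp only [dilation, pole_apply_zero]
  module

lemma dilation_ne_zero {p : EuclideanSpace ℝ (Fin 4)} (hp : p ≠ 0) (t : ℝ) :
    dilation t p ≠ 0 := by
  intro h
  apply hp
  have := dilation_dilation (-t) t p
  rw [h] at this
  simpa [dilation] using this.symm

/-- The ambient extension of the model maps of `S^3 × S^1`: a projectivized dilation of `ℝ^4`, by a
time that is a linear function of the second coordinate, over a linear map of `ℝ^2`. -/
def ambientMap (c u : ℂ) (y : Ambient) : Ambient :=
  (NormedSpace.normalize (dilation (c * planeIso.symm y.2).re y.1),
    planeIso (u * planeIso.symm y.2))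

/-- Dilations are linear and commuting, and normalization ignores positive factors, so the dilation
times add. The second time is read at the rotated point, hence the twist $c'u$. -/
lemma ambientMap_ambientMap (c u c' u' : ℂ) {y : Ambient} (hy : y.1 ≠ 0) :
    ambientMap c' u' (ambientMap c u y) = ambientMap (c + c' * u) (u' * u) y := by
  have h0 := dilation_ne_zero hy (c * planeIso.symm y.2).re
  simp only [ambientMap, LinearIsometryEquiv.symm_apply_apply]
  congr 1
  · nth_rewrite 2 [NormedSpace.normalize]
    rw [dilation_smul, NormedSpace.normalize_smul_of_pos (by positivity), dilation_dilation]
    congr 2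
    rw [← Complex.add_re]
    ring_nf
  · rw [mul_assoc]

/-- Smoothness is joint in the parameters, so that compactness later gives bounds uniform in $c$ and
$u$. -/
lemma contDiffAt_ambientMap (z : (ℂ × ℂ) × Ambient) (hz : z.2.1 ≠ 0) :
    ContDiffAt ℝ ∞ (fun z : (ℂ × ℂ) × Ambient => ambientMap z.1.1 z.1.2 z.2) z := by
  have h1 : ContDiff ℝ ∞ (fun z : (ℂ × ℂ) × Ambient => planeIso.symm z.2.2) :=
    planeIso.symm.contDiff.comp contDiff_snd.snd
  have h2 : ContDiff ℝ ∞ (fun z : (ℂ × ℂ) × Ambient => (z.1.1 * planeIso.symm z.2.2).re) :=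
    Complex.reCLM.contDiff.comp (contDiff_fst.fst.mul h1)
  have h0 : ContDiff ℝ ∞ (fun z : (ℂ × ℂ) × Ambient => z.2.1 0) :=
    contDiff_euclidean.1 contDiff_snd.fst 0
  have h3 : ContDiff ℝ ∞ (fun z : (ℂ × ℂ) × Ambient =>
      dilation (z.1.1 * planeIso.symm z.2.2).re z.2.1) := by
    unfold dilation
    exact (h2.exp.smul contDiff_snd.fst).add
      (((contDiff_const.sub h2.exp).mul h0).smul contDiff_const)
  have h4 := dilation_ne_zero hz (z.1.1 * planeIso.symm z.2.2).re
  refine ContDiffAt.prodMk ?_ ?_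
  · unfold NormedSpace.normalize
    exact ((h3.contDiffAt.norm ℝ h4).inv (norm_ne_zero_iff.2 h4)).smul h3.contDiffAt
  · exact (planeIso.contDiff.comp (contDiff_fst.snd.mul h1)).contDiffAt

lemma contDiffAt_ambientMap_right (c u : ℂ) {y : Ambient} (hy : y.1 ≠ 0) :
    ContDiffAt ℝ ∞ (ambientMap c u) y :=
  (contDiffAt_ambientMap ((c, u), y) hy).comp y
    (contDiff_const.prodMk contDiff_id).contDiffAt

/-- The derivative of `ambientMap c u` depends continuously on all data. -/
lemma continuousAt_fderiv_ambientMap (z : (ℂ × ℂ) × Ambient) (hz : z.2.1 ≠ 0) :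
    ContinuousAt (fun z : (ℂ × ℂ) × Ambient => fderiv ℝ (ambientMap z.1.1 z.1.2) z.2) z := by
  have h := contDiffAt_ambientMap z hz
  -- The derivative in $y$ alone is the joint derivative restricted to the last factor, and the
  -- joint derivative is continuous.
  have hev : ∀ᶠ w in 𝓝 z, fderiv ℝ (ambientMap w.1.1 w.1.2) w.2 =
      (fderiv ℝ (fun z : (ℂ × ℂ) × Ambient => ambientMap z.1.1 z.1.2 z.2) w).comp
        (ContinuousLinearMap.inr ℝ (ℂ × ℂ) Ambient) := by
    have ho : ∀ᶠ w : (ℂ × ℂ) × Ambient in 𝓝 z, w.2.1 ≠ 0 :=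
      (continuous_snd.fst.continuousAt).eventually_ne hz
    filter_upwards [ho] with w hw
    have hd := ((contDiffAt_ambientMap w hw).differentiableAt (by simp)).hasFDerivAt
    exact (HasFDerivAt.comp (f := fun y : Ambient => (w.1, y)) w.2 hd
      (hasFDerivAt_prodMk_right (𝕜 := ℝ) w.1 w.2)).fderiv
  refine ContinuousAt.congr ?_ (hev.mono fun _ h => h.symm)
  exact ((h.fderiv_right (m := 0) (by simp)).continuousAt).clm_comp continuousAt_const

lemma fact_finrank_euclideanSpace_succ (n : ℕ) :
    Fact (Module.finrank ℝ (EuclideanSpace ℝ (Fin (n + 1))) = n + 1) := ⟨by simp⟩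

lemma fact_finrank_euclideanSpace_four :
    Fact (Module.finrank ℝ (EuclideanSpace ℝ (Fin 4)) = 3 + 1) := ⟨by simp⟩

lemma fact_finrank_euclideanSpace_two :
    Fact (Module.finrank ℝ (EuclideanSpace ℝ (Fin 2)) = 1 + 1) := ⟨by simp⟩

attribute [local instance] fact_finrank_euclideanSpace_succ
attribute [local instance] fact_finrank_euclideanSpace_four
attribute [local instance] fact_finrank_euclideanSpace_two

/-! ### Model maps as diffeomorphisms -/

/-- The inclusion of `S^3 × S^1` into `ℝ^4 × ℝ^2`. -/
def inclusion (p : M) : Ambient := (p.1, p.2)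

lemma contMDiff_inclusion : ContMDiff IM 𝓘(ℝ, Ambient) ∞ inclusion :=
  (contMDiff_coe_sphere.comp contMDiff_fst).prodMk_space
    (contMDiff_coe_sphere.comp contMDiff_snd)

lemma continuous_inclusion : Continuous inclusion := contMDiff_inclusion.continuous

lemma inclusion_injective : Function.Injective inclusion := fun _ _ h =>
  Prod.ext (Subtype.ext (congrArg Prod.fst h)) (Subtype.ext (congrArg Prod.snd h))

lemma inclusion_fst_ne_zero (p : M) : (inclusion p).1 ≠ 0 := ne_zero_of_mem_unit_sphere p.1

/-- The diffeomorphism of `S^3 × S^1` that is the restriction of `ambientMap c u`. -/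
def modelMap (c : ℂ) (u : Circle) (p : M) : M :=
  (⟨(ambientMap c u (inclusion p)).1, by
      have := dilation_ne_zero (inclusion_fst_ne_zero p) (c * planeIso.symm (inclusion p).2).re
      simpa [ambientMap] using NormedSpace.norm_normalize this⟩,
    ⟨(ambientMap c u (inclusion p)).2, by
      simp only [ambientMap, inclusion, mem_sphere_zero_iff_norm, LinearIsometryEquiv.norm_map,
        norm_mul, Circle.norm_coe, one_mul, norm_eq_of_mem_sphere]⟩)

lemma inclusion_modelMap (c : ℂ) (u : Circle) (p : M) :
    inclusion (modelMap c u p) = ambientMap c u (inclusion p) := rfl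

lemma modelMap_modelMap (c c' : ℂ) (u u' : Circle) (p : M) :
    modelMap c' u' (modelMap c u p) = modelMap (c + c' * u) (u' * u) p := by
  apply inclusion_injective
  simp only [inclusion_modelMap, Circle.coe_mul,
    ambientMap_ambientMap c u c' u' (inclusion_fst_ne_zero p)]

@[simp] lemma modelMap_zero_one (p : M) : modelMap 0 1 p = p := by
  apply inclusion_injective
  rw [inclusion_modelMap]
  simp only [ambientMap, inclusion, zero_mul, Complex.zero_re, dilation_zero, Circle.coe_one,
    one_mul, LinearIsometryEquiv.apply_symm_apply, NormedSpace.normalize, norm_eq_of_mem_sphere,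
    inv_one, one_smul]

lemma contMDiff_modelMap (c : ℂ) (u : Circle) : ContMDiff IM IM ∞ (modelMap c u) := by
  have h : ContMDiff IM 𝓘(ℝ, Ambient) ∞ (fun p => ambientMap c u (inclusion p)) := fun p =>
    (contDiffAt_ambientMap_right c u (inclusion_fst_ne_zero p)).contMDiffAt.comp p
      (contMDiff_inclusion p)
  refine ContMDiff.prodMk ?_ ?_
  · exact ContMDiff.codRestrict_sphere
      (f := fun p => (ambientMap c u (inclusion p)).1) (contDiff_fst.contMDiff.comp h)
      (fun p => (modelMap c u p).1.2)
  · exact ContMDiff.codRestrict_sphere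
      (f := fun p => (ambientMap c u (inclusion p)).2) (contDiff_snd.contMDiff.comp h)
      (fun p => (modelMap c u p).2.2)

/-- `modelMap c u` as a diffeomorphism. -/
def modelDiffeo (c : ℂ) (u : Circle) : DiffM where
  toFun := modelMap c u
  invFun := modelMap (-c * (u⁻¹ : Circle)) u⁻¹
  left_inv p := by
    rw [modelMap_modelMap, mul_assoc, ← Circle.coe_mul, inv_mul_cancel]
    simp
  right_inv p := by
    rw [modelMap_modelMap, mul_inv_cancel]
    simp
  contMDiff_toFun := contMDiff_modelMap _ _
  contMDiff_invFun := contMDiff_modelMap _ _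

/-! ### Tangent vectors in ambient coordinates -/

/-- The embedding of the tangent space at `p` into `ℝ^4 × ℝ^2`. -/
def tangentEmbed (p : M) : TangentSpace IM p →L[ℝ] Ambient :=
  (mvfderiv IM (fun q : M => (q.1 : EuclideanSpace ℝ (Fin 4))) p).prod
    (mvfderiv IM (fun q : M => (q.2 : EuclideanSpace ℝ (Fin 2))) p)

/-- The Euclidean norm of `ℝ^4 × ℝ^2`. -/
def ambientNorm (y : Ambient) : ℝ := Real.sqrt (‖y.1‖ ^ 2 + ‖y.2‖ ^ 2)

lemma tangentNorm_eq (p : M) (v : TangentSpace IM p) :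
    tangentNorm p v = ambientNorm (tangentEmbed p v) := rfl

lemma hasMFDerivAt_inclusion (p : M) :
    HasMFDerivAt IM 𝓘(ℝ, Ambient) inclusion p (tangentEmbed p) := by
  have h1 : MDifferentiableAt IM 𝓘(ℝ, EuclideanSpace ℝ (Fin 4))
      (fun q : M => (q.1 : EuclideanSpace ℝ (Fin 4))) p :=
    ((contMDiff_coe_sphere (m := ∞)).comp contMDiff_fst).mdifferentiableAt (by simp)
  have h2 : MDifferentiableAt IM 𝓘(ℝ, EuclideanSpace ℝ (Fin 2))
      (fun q : M => (q.2 : EuclideanSpace ℝ (Fin 2))) p :=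
    ((contMDiff_coe_sphere (m := ∞)).comp contMDiff_snd).mdifferentiableAt (by simp)
  exact ⟨h1.hasMFDerivAt.1.prodMk h2.hasMFDerivAt.1, h1.hasMFDerivAt.2.prodMk h2.hasMFDerivAt.2⟩

/-- Both sides differentiate the same map, inclusion after model map or ambient map after inclusion.
Manifold derivatives thus become Euclidean ones. -/
lemma tangentEmbed_mfderiv_modelMap (c : ℂ) (u : Circle) (p : M) (v : TangentSpace IM p) :
    tangentEmbed (modelMap c u p) (mfderiv IM IM (modelMap c u) p v) =
      fderiv ℝ (ambientMap c u) (inclusion p) (tangentEmbed p v) := by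
  have h1 := (hasMFDerivAt_inclusion (modelMap c u p)).comp p
    ((contMDiff_modelMap c u).mdifferentiableAt (by simp)).hasMFDerivAt
  have h2 := (((contDiffAt_ambientMap_right c u (inclusion_fst_ne_zero p)).differentiableAt
    (by simp)).hasFDerivAt.hasMFDerivAt).comp p (hasMFDerivAt_inclusion p)
  exact DFunLike.congr_fun (hasMFDerivAt_unique h1 h2) v

lemma tangentEmbed_eq (p : M) (v : TangentSpace IM p) :
    tangentEmbed p v = (mvfderiv (𝓡 3) ((↑) : Sph 3 → EuclideanSpace ℝ (Fin 4)) p.1 v.1,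
      mvfderiv (𝓡 1) ((↑) : Sph 1 → EuclideanSpace ℝ (Fin 2)) p.2 v.2) := by
  have h1 := (((contMDiff_coe_sphere (E := EuclideanSpace ℝ (Fin 4)) (m := ∞) (n := 3)
    ).mdifferentiableAt (by simp) (x := p.1)).hasMFDerivAt).comp p (hasMFDerivAt_fst (I := 𝓡 3) (I' := 𝓡 1) p)
  have h2 := (((contMDiff_coe_sphere (E := EuclideanSpace ℝ (Fin 2)) (m := ∞) (n := 1)
    ).mdifferentiableAt (by simp) (x := p.2)).hasMFDerivAt).comp p (hasMFDerivAt_snd (I := 𝓡 3) (I' := 𝓡 1) p)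
  exact Prod.ext (DFunLike.congr_fun h1.mfderiv v) (DFunLike.congr_fun h2.mfderiv v)

lemma tangentEmbed_injective (p : M) : Function.Injective (tangentEmbed p) := by
  intro v w h
  rw [tangentEmbed_eq, tangentEmbed_eq] at h
  exact Prod.ext (injective_mvfderiv_subtypeVal_sphere p.1 (congrArg Prod.fst h))
    (injective_mvfderiv_subtypeVal_sphere p.2 (congrArg Prod.snd h))

/-- The tangent space of `S^3 × S^1`, as a subspace of `ℝ^4 × ℝ^2`. -/
lemma exists_tangentEmbed_eq_iff (p : M) (y : Ambient) :
    (∃ v, tangentEmbed p v = y) ↔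
      inner ℝ (p.1 : EuclideanSpace ℝ (Fin 4)) y.1 = 0 ∧
        inner ℝ (p.2 : EuclideanSpace ℝ (Fin 2)) y.2 = 0 := by
  rw [← Submodule.mem_orthogonal_singleton_iff_inner_right,
    ← Submodule.mem_orthogonal_singleton_iff_inner_right,
    ← range_mvfderiv_subtypeVal (n := 3) p.1, ← range_mvfderiv_subtypeVal (n := 1) p.2]
  constructor
  · rintro ⟨v, rfl⟩
    rw [tangentEmbed_eq]
    exact ⟨⟨v.1, rfl⟩, ⟨v.2, rfl⟩⟩
  · rintro ⟨⟨a, ha⟩, ⟨b, hb⟩⟩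
    exact ⟨(a, b), (tangentEmbed_eq p (a, b)).trans (Prod.ext ha hb)⟩

lemma continuous_ambientNorm : Continuous ambientNorm := by
  unfold ambientNorm
  fun_prop

lemma ambientNorm_eq_zero {y : Ambient} : ambientNorm y = 0 ↔ y = 0 := by
  rw [ambientNorm, Real.sqrt_eq_zero (by positivity), Prod.ext_iff]
  constructor
  · intro h
    constructor
    · exact norm_eq_zero.1 (by nlinarith [norm_nonneg y.1, norm_nonneg y.2])
    · exact norm_eq_zero.1 (by nlinarith [norm_nonneg y.1, norm_nonneg y.2])
  · rintro ⟨h, h'⟩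
    simp [h, h']

lemma norm_le_ambientNorm (y : Ambient) : ‖y‖ ≤ ambientNorm y := by
  rw [Prod.norm_def]
  exact max_le (Real.le_sqrt_of_sq_le (by nlinarith [sq_nonneg ‖y.2‖]))
    (Real.le_sqrt_of_sq_le (by nlinarith [sq_nonneg ‖y.1‖]))

lemma ambientNorm_le_two_mul_norm (y : Ambient) : ambientNorm y ≤ 2 * ‖y‖ := by
  rw [ambientNorm, Real.sqrt_le_left (by positivity)]
  nlinarith [norm_fst_le y, norm_snd_le y, norm_nonneg y.1, norm_nonneg y.2]

lemma tangentNorm_pos {p : M} {v : TangentSpace IM p} (hv : v ≠ 0) : 0 < tangentNorm p v := by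
  refine lt_of_le_of_ne (Real.sqrt_nonneg _) fun h => hv ?_
  apply tangentEmbed_injective p
  rw [map_zero]
  exact ambientNorm_eq_zero.1 h.symm

lemma tangentNorm_smul {p : M} (r : ℝ) (v : TangentSpace IM p) :
    tangentNorm p (r • v) = |r| * tangentNorm p v := by
  rw [tangentNorm_eq, tangentNorm_eq, map_smul, ambientNorm, ambientNorm, Prod.smul_fst,
    Prod.smul_snd, norm_smul, norm_smul, Real.norm_eq_abs, ← Real.sqrt_sq (abs_nonneg r),
    ← Real.sqrt_mul (sq_nonneg _), Real.sqrt_sq (abs_nonneg r)]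
  ring_nf

/-! ### Uniform derivative bounds -/

/-- The length of the image of the tangent vector `v` at `p` under the derivative of `f`. -/
def imageNorm (f : M → M) (p : M) (v : TangentSpace IM p) : ℝ :=
  tangentNorm (f p) (mfderiv IM IM f p v)

/-- The operator norm of the derivative of `f` at `p`. -/
def derivNorm (f : M → M) (p : M) : ℝ :=
  sSup {r : ℝ | ∃ v : TangentSpace IM p, tangentNorm p v ≤ 1 ∧ r = imageNorm f p v}

lemma imageNorm_modelMap (c : ℂ) (u : Circle) (p : M) (v : TangentSpace IM p) :
    imageNorm (modelMap c u) p v =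
      ambientNorm (fderiv ℝ (ambientMap c u) (inclusion p) (tangentEmbed p v)) := by
  rw [imageNorm, tangentNorm_eq, tangentEmbed_mfderiv_modelMap]

lemma exists_imageNorm_modelMap_le (B : ℝ) : ∃ K : ℝ, 1 ≤ K ∧
    ∀ (c : ℂ) (u : Circle) (p : M) (v : TangentSpace IM p), ‖c‖ ≤ B →
      imageNorm (modelMap c u) p v ≤ K * tangentNorm p v := by
  have hS : IsCompact ((Metric.closedBall (0 : ℂ) B ×ˢ Metric.sphere (0 : ℂ) 1) ×ˢ
      Set.range inclusion) :=
    ((isCompact_closedBall _ _).prod (isCompact_sphere _ _)).prod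
      (isCompact_range continuous_inclusion)
  obtain ⟨K, hK⟩ := hS.exists_bound_of_continuousOn
    (f := fun z : (ℂ × ℂ) × Ambient => fderiv ℝ (ambientMap z.1.1 z.1.2) z.2) (by
      rintro ⟨⟨c, u⟩, y⟩ ⟨-, ⟨p, rfl⟩⟩
      exact (continuousAt_fderiv_ambientMap _ (inclusion_fst_ne_zero p)).continuousWithinAt)
  -- The factor 2 compares the Euclidean norm with the sup norm that the product carries.
  refine ⟨max 1 (2 * K), le_max_left _ _, fun c u p v hc => ?_⟩
  have h := hK ((c, u), inclusion p) ⟨⟨by simpa using hc, by simp [Circle.norm_coe]⟩, ⟨p, rfl⟩⟩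
  have hK0 : 0 ≤ K := (norm_nonneg _).trans h
  rw [imageNorm_modelMap]
  have h0 : 0 ≤ tangentNorm p v := Real.sqrt_nonneg _
  calc _ ≤ 2 * ‖fderiv ℝ (ambientMap c u) (inclusion p) (tangentEmbed p v)‖ :=
        ambientNorm_le_two_mul_norm _
    _ ≤ 2 * (K * ‖tangentEmbed p v‖) := by
        gcongr
        exact (ContinuousLinearMap.le_opNorm _ _).trans (by gcongr)
    _ ≤ 2 * (K * tangentNorm p v) := by
        gcongr
        exact norm_le_ambientNorm _
    _ ≤ _ := by
        rw [← mul_assoc]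
        gcongr
        exact le_max_right _ _

/-- The model maps with bounded first parameter are uniformly bi-Lipschitz on tangent vectors. -/
lemma exists_imageNorm_modelMap_bounds (B : ℝ) : ∃ K : ℝ, 1 ≤ K ∧
    ∀ (c : ℂ) (u : Circle) (p : M) (v : TangentSpace IM p), ‖c‖ ≤ B →
      K⁻¹ * tangentNorm p v ≤ imageNorm (modelMap c u) p v ∧
        imageNorm (modelMap c u) p v ≤ K * tangentNorm p v := by
  obtain ⟨K, hK1, hK⟩ := exists_imageNorm_modelMap_le B
  refine ⟨K, hK1, fun c u p v hc => ⟨?_, hK c u p v hc⟩⟩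
  have hinv : modelMap (-c * (u⁻¹ : Circle)) u⁻¹ ∘ modelMap c u = id :=
    funext (modelDiffeo c u).left_inv
  have hcomp := mfderiv_comp p
    ((contMDiff_modelMap (-c * (u⁻¹ : Circle)) u⁻¹).mdifferentiableAt (by simp)
      (x := modelMap c u p))
    ((contMDiff_modelMap c u).mdifferentiableAt (by simp))
  -- The inverse is a model map whose first parameter has the same modulus, so the upper bound for
  -- it is the lower bound sought.
  have h := hK (-c * (u⁻¹ : Circle)) u⁻¹ (modelMap c u p)
    (mfderiv IM IM (modelMap c u) p v) (by simpa [Circle.norm_coe] using hc)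
  have heq : imageNorm (modelMap (-c * (u⁻¹ : Circle)) u⁻¹) (modelMap c u p)
      (mfderiv IM IM (modelMap c u) p v) = tangentNorm p v := by
    have h1 : imageNorm (modelMap (-c * (u⁻¹ : Circle)) u⁻¹ ∘ modelMap c u) p v =
        imageNorm (modelMap (-c * (u⁻¹ : Circle)) u⁻¹) (modelMap c u p)
          (mfderiv IM IM (modelMap c u) p v) := by
      unfold imageNorm
      rw [hcomp]
      rfl
    rw [← h1, hinv]
    unfold imageNorm
    rw [mfderiv_id]
    rfl
  rw [heq] at h
  rw [inv_mul_le_iff₀ (by positivity)]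
  exact h

lemma abs_log_le_of_bounds {K r : ℝ} (hK : 1 ≤ K) (h1 : K⁻¹ ≤ r) (h2 : r ≤ K) :
    |Real.log r| ≤ Real.log K := by
  have hK0 : 0 < K := by positivity
  have hr : 0 < r := (inv_pos.2 hK0).trans_le h1
  rw [abs_le]
  constructor
  · rw [← Real.log_inv]
    exact Real.log_le_log (inv_pos.2 hK0) h1
  · exact Real.log_le_log hr h2

lemma exists_tangentNorm_eq_one (p : M) : ∃ v : TangentSpace IM p, tangentNorm p v = 1 := by
  obtain ⟨v, hv⟩ := exists_ne (0 : EuclideanSpace ℝ (Fin 3) × EuclideanSpace ℝ (Fin 1))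
  let w : TangentSpace IM p := v
  have hw : 0 < tangentNorm p w := tangentNorm_pos hv
  refine ⟨(tangentNorm p w)⁻¹ • w, ?_⟩
  rw [tangentNorm_smul, abs_of_pos (inv_pos.2 hw), inv_mul_cancel₀ hw.ne']

lemma exists_abs_log_derivNorm_modelMap_le (B : ℝ) : ∃ L : ℝ, ∀ (c : ℂ) (u : Circle) (p : M),
    ‖c‖ ≤ B → |Real.log (derivNorm (modelMap c u) p)| ≤ L := by
  obtain ⟨K, hK1, hK⟩ := exists_imageNorm_modelMap_bounds B
  refine ⟨Real.log K, fun c u p hc => ?_⟩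
  obtain ⟨w, hw⟩ := exists_tangentNorm_eq_one p
  have hub : ∀ r ∈ {r : ℝ | ∃ v : TangentSpace IM p, tangentNorm p v ≤ 1 ∧
      r = imageNorm (modelMap c u) p v}, r ≤ K := by
    rintro r ⟨v, hv, rfl⟩
    exact (hK c u p v hc).2.trans (mul_le_of_le_one_right (by positivity) hv)
  have hmem : imageNorm (modelMap c u) p w ∈ {r : ℝ | ∃ v : TangentSpace IM p,
      tangentNorm p v ≤ 1 ∧ r = imageNorm (modelMap c u) p v} := ⟨w, hw.le, rfl⟩
  refine abs_log_le_of_bounds hK1 ?_ (csSup_le ⟨_, hmem⟩ hub)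
  refine le_trans ?_ (le_csSup ⟨K, hub⟩ hmem)
  simpa [hw] using (hK c u p w hc).1

/-! ### Continuity of the operator norm -/

/-- The orthogonal projection of `ℝ^4 × ℝ^2` to the tangent space at `p`. -/
def tangentProj (p : M) (w : Ambient) : Ambient :=
  (w.1 - (inner ℝ (p.1 : EuclideanSpace ℝ (Fin 4)) w.1) • (p.1 : EuclideanSpace ℝ (Fin 4)),
    w.2 - (inner ℝ (p.2 : EuclideanSpace ℝ (Fin 2)) w.2) • (p.2 : EuclideanSpace ℝ (Fin 2)))

lemma norm_sub_inner_smul_sq_le {E : Type*} [NormedAddCommGroup E] [InnerProductSpace ℝ E]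
    {p : E} (hp : ‖p‖ = 1) (w : E) : ‖w - inner ℝ p w • p‖ ^ 2 ≤ ‖w‖ ^ 2 := by
  rw [norm_sub_sq_real, inner_smul_right, norm_smul, hp, real_inner_comm, mul_one,
    Real.norm_eq_abs, sq_abs]
  nlinarith [sq_nonneg (inner ℝ p w)]

lemma ambientNorm_tangentProj_le (p : M) (w : Ambient) :
    ambientNorm (tangentProj p w) ≤ ambientNorm w :=
  Real.sqrt_le_sqrt (add_le_add
    (norm_sub_inner_smul_sq_le (norm_eq_of_mem_sphere p.1) _)
    (norm_sub_inner_smul_sq_le (norm_eq_of_mem_sphere p.2) _))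

lemma exists_tangentEmbed_eq_tangentProj (p : M) (w : Ambient) :
    ∃ v, tangentEmbed p v = tangentProj p w := by
  rw [exists_tangentEmbed_eq_iff]
  simp [tangentProj, inner_sub_right, inner_smul_right, norm_eq_of_mem_sphere]

lemma tangentProj_tangentEmbed (p : M) (v : TangentSpace IM p) :
    tangentProj p (tangentEmbed p v) = tangentEmbed p v := by
  obtain ⟨h1, h2⟩ := (exists_tangentEmbed_eq_iff p (tangentEmbed p v)).1 ⟨v, rfl⟩
  rw [tangentProj, h1, h2]
  simp

lemma continuous_tangentProj : Continuous fun z : M × Ambient => tangentProj z.1 z.2 := by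
  unfold tangentProj
  fun_prop

/-- Projecting ambient vectors replaces the unit ball of $T_pM$ by a compact set independent of $p$,
so the supremum depends continuously on all data. -/
lemma derivNorm_modelMap_eq (c : ℂ) (u : Circle) (p : M) :
    derivNorm (modelMap c u) p =
      sSup ((fun w => ambientNorm (fderiv ℝ (ambientMap c u) (inclusion p) (tangentProj p w))) ''
        {w | ambientNorm w ≤ 1}) := by
  unfold derivNorm
  congr 1
  ext r
  constructor
  · rintro ⟨v, hv, rfl⟩
    exact ⟨tangentEmbed p v, hv, by
      simp only [tangentProj_tangentEmbed, imageNorm_modelMap]⟩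
  · rintro ⟨w, hw, rfl⟩
    obtain ⟨v, hv⟩ := exists_tangentEmbed_eq_tangentProj p w
    refine ⟨v, ?_, ?_⟩
    · rw [tangentNorm_eq, hv]
      exact (ambientNorm_tangentProj_le p w).trans hw
    · simp only [imageNorm_modelMap, hv]

lemma isCompact_ambientNorm_le_one : IsCompact {w : Ambient | ambientNorm w ≤ 1} :=
  (isCompact_closedBall (0 : Ambient) 1).of_isClosed_subset
    (isClosed_le continuous_ambientNorm continuous_const)
    fun w hw => by simpa using (norm_le_ambientNorm w).trans hw

lemma continuous_derivNorm_modelMap :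
    Continuous fun z : (ℂ × Circle) × M => derivNorm (modelMap z.1.1 z.1.2) z.2 := by
  simp only [derivNorm_modelMap_eq]
  refine isCompact_ambientNorm_le_one.continuous_sSup (f := fun (z : (ℂ × Circle) × M)
    (w : Ambient) => ambientNorm
      (fderiv ℝ (ambientMap z.1.1 z.1.2) (inclusion z.2) (tangentProj z.2 w))) ?_
  have h1 : Continuous fun z : (ℂ × Circle) × M =>
      fderiv ℝ (ambientMap z.1.1 z.1.2) (inclusion z.2) := by
    refine continuous_iff_continuousAt.2 fun z => ?_
    refine (continuousAt_fderiv_ambientMap ((z.1.1, z.1.2), inclusion z.2)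
      (inclusion_fst_ne_zero z.2)).comp
      (f := fun z : (ℂ × Circle) × M => ((z.1.1, (z.1.2 : ℂ)), inclusion z.2)) ?_
    have := continuous_inclusion
    fun_prop
  refine continuous_ambientNorm.comp ((h1.comp continuous_fst).clm_apply ?_)
  exact continuous_tangentProj.comp (continuous_fst.snd.prodMk continuous_snd)

/-! ### The derivative over the pole -/

/-- The pole as a point of `S^3`. -/
def polePoint : Sph 3 := ⟨pole, by simp⟩

lemma modelMap_polePoint (c : ℂ) (u : Circle) (q : Sph 1) :
    modelMap c u (polePoint, q) = (polePoint, (modelMap c u (polePoint, q)).2) := by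
  refine Prod.ext (Subtype.ext ?_) rfl
  simp [modelMap, ambientMap, inclusion, polePoint, NormedSpace.normalize]

/-- The pole is fixed for every dilation time, so varying $q$ does not move the first component to
first order. Normalization has no first-order effect either, because `w.1` is orthogonal to the
pole. -/
lemma fderiv_ambientMap_pole (c u : ℂ) (q : EuclideanSpace ℝ (Fin 2)) (w : Ambient)
    (hw : w.1 0 = 0) :
    fderiv ℝ (ambientMap c u) (pole, q) w =
      (Real.exp (c * planeIso.symm q).re • w.1, planeIso (u * planeIso.symm w.2)) := by
  have hd : DifferentiableAt ℝ (ambientMap c u) (pole, q) :=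
    (contDiffAt_ambientMap_right c u (y := (pole, q))
      (norm_ne_zero_iff.1 (by simp))).differentiableAt (by simp)
  have hline := hd.hasFDerivAt.hasLineDerivAt w
  refine HasDerivAt.unique hline ?_
  set t : ℝ := (c * planeIso.symm q).re
  set t' : ℝ := (c * planeIso.symm w.2).re
  have hg : HasDerivAt (fun s : ℝ => s * Real.exp (t + s * t')) (Real.exp t) 0 := by
    have := (hasDerivAt_id (0 : ℝ)).mul (((hasDerivAt_id (0 : ℝ)).mul_const t').const_add t).exp
    simpa using! this
  have hy : HasDerivAt (fun s : ℝ => pole + (s * Real.exp (t + s * t')) • w.1)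
      (Real.exp t • w.1) 0 := (hg.smul_const w.1).const_add pole
  have hn : HasDerivAt (fun s : ℝ => ‖pole + (s * Real.exp (t + s * t')) • w.1‖ ^ 2) 0 0 := by
    have := hy.norm_sq
    simpa [inner_smul_right, inner_pole_left, hw] using this
  have hi : HasDerivAt (fun s : ℝ => ‖pole + (s * Real.exp (t + s * t')) • w.1‖⁻¹) 0 0 := by
    have := (hn.sqrt (by simp)).inv (by simp)
    simpa [Real.sqrt_sq] using! this
  have h1 := hi.smul hy
  have h2 : HasDerivAt (fun s : ℝ => planeIso (u * planeIso.symm q) +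
      s • planeIso (u * planeIso.symm w.2)) (planeIso (u * planeIso.symm w.2)) 0 := by
    simpa using ((hasDerivAt_id (0 : ℝ)).smul_const
      (planeIso (u * planeIso.symm w.2))).const_add (planeIso (u * planeIso.symm q))
  refine (h1.prodMk h2).congr_deriv ?_ |>.congr_of_eventuallyEq (.of_forall fun s => ?_)
  · simp
  · refine Prod.ext ?_ ?_
    · simp only [ambientMap, NormedSpace.normalize]
      have : dilation (c * planeIso.symm ((pole, q) + s • w).2).re ((pole, q) + s • w).1 =
          pole + (s * Real.exp (t + s * t')) • w.1 := by
        have ht : (c * planeIso.symm ((pole, q) + s • w).2).re = t + s * t' := by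
          simp only [Prod.snd_add, Prod.smul_snd, map_add, map_smul, mul_add, Complex.add_re,
            mul_smul_comm, Complex.smul_re, smul_eq_mul, t, t']
        rw [ht, dilation]
        simp only [Prod.fst_add, Prod.smul_fst, PiLp.add_apply, PiLp.smul_apply, hw,
          pole_apply_zero, smul_eq_mul]
        module
      rw [this]
      rfl
    · simp only [ambientMap, Prod.snd_add, Prod.smul_snd, map_add, map_smul, mul_add,
        mul_smul_comm]

/-- Over the pole, the norm of the derivative of an expanding model map. -/
lemma derivNorm_modelMap_polePoint (c : ℂ) (u : Circle) (q : Sph 1)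
    (h : 0 ≤ (c * planeIso.symm (q : EuclideanSpace ℝ (Fin 2))).re) :
    derivNorm (modelMap c u) (polePoint, q) =
      Real.exp (c * planeIso.symm (q : EuclideanSpace ℝ (Fin 2))).re := by
  set t : ℝ := (c * planeIso.symm (q : EuclideanSpace ℝ (Fin 2))).re with ht
  have key : ∀ v : TangentSpace IM ((polePoint, q) : M),
      imageNorm (modelMap c u) (polePoint, q) v =
        Real.sqrt (Real.exp t ^ 2 * ‖(tangentEmbed (polePoint, q) v).1‖ ^ 2 +
          ‖(tangentEmbed (polePoint, q) v).2‖ ^ 2) := by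
    intro v
    have h0 := ((exists_tangentEmbed_eq_iff _ _).1 ⟨v, rfl⟩).1
    have h1 : (tangentEmbed (polePoint, q) v).1 0 = 0 := by
      rw [← inner_pole_left]
      exact h0
    have h2 := fderiv_ambientMap_pole c u q _ h1
    rw [imageNorm_modelMap]
    change ambientNorm (fderiv ℝ (ambientMap c u) (pole, (q : EuclideanSpace ℝ (Fin 2))) _) = _
    rw [h2, ambientNorm, ← ht]
    simp [norm_smul, mul_pow, Circle.norm_coe]
  -- The circle direction is mapped isometrically; it does not exceed the factor $e^t$ because
  -- $t\ge0$.
  have h1 : 1 ≤ Real.exp t := Real.one_le_exp h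
  have hub : ∀ r ∈ {r : ℝ | ∃ v : TangentSpace IM ((polePoint, q) : M),
      tangentNorm (polePoint, q) v ≤ 1 ∧ r = imageNorm (modelMap c u) (polePoint, q) v},
      r ≤ Real.exp t := by
    rintro r ⟨v, hv, rfl⟩
    rw [tangentNorm_eq, ambientNorm, Real.sqrt_le_left zero_le_one, one_pow] at hv
    rw [key, Real.sqrt_le_left (by positivity)]
    nlinarith [sq_nonneg ‖(tangentEmbed (polePoint, q) v).2‖,
      sq_nonneg ‖(tangentEmbed (polePoint, q) v).1‖, one_le_pow₀ h1 (n := 2)]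
  obtain ⟨v, hv⟩ := (exists_tangentEmbed_eq_iff (polePoint, q)
    (EuclideanSpace.single 1 1, 0)).2 ⟨by simp [polePoint, inner_pole_left], by simp⟩
  have hmem : Real.exp t ∈ {r : ℝ | ∃ v : TangentSpace IM ((polePoint, q) : M),
      tangentNorm (polePoint, q) v ≤ 1 ∧ r = imageNorm (modelMap c u) (polePoint, q) v} := by
    refine ⟨v, ?_, ?_⟩
    · simp [tangentNorm_eq, hv, ambientNorm]
    · rw [key, hv]
      simp [Real.sqrt_sq (Real.exp_nonneg t)]
  exact (IsGreatest.csSup_eq ⟨hmem, hub⟩)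

/-! ### The cocycle and its drift -/

/-- The sign attached to a symbol. -/
def symbolSign (i : Fin 2) : ℂ := if i = 0 then 1 else -1

lemma norm_symbolSign (i : Fin 2) : ‖symbolSign i‖ = 1 := by
  unfold symbolSign
  split_ifs <;> simp

/-- The rotation of the circle by one radian. -/
def rotation : Circle := Circle.exp 1

/-- Otherwise $m$ would be an integer multiple of $2\pi$. -/
lemma rotation_pow_ne_one {m : ℕ} (hm : 0 < m) : (rotation : ℂ) ^ m ≠ 1 := by
  intro h
  have h1 : Circle.exp (m : ℝ) = 1 := by
    have : Circle.exp 1 ^ m = 1 := Circle.ext (by simpa [rotation] using h)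
    rwa [← Circle.exp_nsmul, nsmul_eq_mul, mul_one] at this
  obtain ⟨k, hk⟩ := Circle.exp_eq_one.1 h1
  have hk0 : (k : ℝ) ≠ 0 := by
    rintro h0
    rw [h0, zero_mul] at hk
    exact hm.ne' (by exact_mod_cast hk)
  refine irrational_pi ⟨(m : ℚ) / (k * 2), ?_⟩
  push_cast
  rw [div_eq_iff (by positivity), hk]
  ring

/-- The cocycle: symbol `0` pushes away from the pole by the height of the base point of the circle,
symbol `1` by its negative, and the circle is rotated in both cases. -/
def cocycle (x : FullShift 2) : DiffM := modelDiffeo (symbolSign (x 0)) rotation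

lemma isLocallyConstant_cocycle : IsLocallyConstant cocycle :=
  (IsLocallyConstant.of_discrete
    (fun i : Fin 2 => modelDiffeo (symbolSign i) rotation)).comp_continuous
    (continuous_apply (0 : ℤ))

/-- The first parameter of the `n`-th iterate of the cocycle. -/
def drift (n : ℕ) (x : FullShift 2) : ℂ :=
  ∑ j ∈ Finset.range n, symbolSign (x j) * (rotation : ℂ) ^ j

lemma shift_iterate_apply (n : ℕ) (x : FullShift 2) (i : ℤ) : shift^[n] x i = x (i + n) := by
  induction n generalizing i with
  | zero => simp
  | succ n ih =>
    rw [Function.iterate_succ_apply', shift, ih]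
    push_cast
    congr 1
    ring

lemma skewProduct_cocycle_iterate (n : ℕ) (x : FullShift 2) (p : M) :
    (skewProduct cocycle)^[n] (x, p) = (shift^[n] x, modelMap (drift n x) (rotation ^ n) p) := by
  induction n with
  | zero => simp [drift]
  | succ n ih =>
    rw [Function.iterate_succ_apply', ih, Function.iterate_succ_apply']
    refine Prod.ext rfl ?_
    change modelMap (symbolSign (shift^[n] x 0)) rotation (modelMap _ _ p) = _
    rw [modelMap_modelMap, shift_iterate_apply, zero_add, drift, drift, Finset.sum_range_succ,
      pow_succ', Circle.coe_pow]

lemma fiberIterate_cocycle (n : ℕ) (x : FullShift 2) :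
    fiberIterate cocycle n x = modelMap (drift n x) (rotation ^ n) := by
  funext p
  rw [fiberIterate, skewProduct_cocycle_iterate]

lemma fiberDerivNorm_cocycle (n : ℕ) (z : FullShift 2 × M) :
    fiberDerivNorm cocycle n z = derivNorm (modelMap (drift n z.1) (rotation ^ n)) z.2 := by
  rw [← fiberIterate_cocycle]
  rfl

lemma tangentNorm_fiberDeriv_cocycle (n : ℕ) (z : FullShift 2 × M) (v : TangentSpace IM z.2) :
    tangentNorm (fiberIterate cocycle n z.1 z.2) (fiberDeriv cocycle n z v) =
      imageNorm (modelMap (drift n z.1) (rotation ^ n)) z.2 v := by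
  rw [← fiberIterate_cocycle]
  rfl

lemma norm_drift_le (n : ℕ) (x : FullShift 2) : ‖drift n x‖ ≤ n := by
  refine (norm_sum_le _ _).trans ?_
  simp [norm_symbolSign, Circle.norm_coe]

lemma drift_add (m n : ℕ) (x : FullShift 2) :
    drift (m + n) x = drift m x + (rotation : ℂ) ^ m * drift n (shift^[m] x) := by
  rw [drift, Finset.sum_range_add, drift, drift, Finset.mul_sum]
  congr 1
  refine Finset.sum_congr rfl fun j _ => ?_
  rw [shift_iterate_apply, pow_add]
  push_cast
  rw [add_comm (m : ℤ)]
  ring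

/-- Along periodic points of the shift the drift is bounded. -/
lemma norm_drift_le_of_isPeriodicPt {m : ℕ} (hm : 0 < m) {x : FullShift 2}
    (hx : Function.IsPeriodicPt shift m x) (n : ℕ) :
    ‖drift n x‖ ≤ m + 2 * (m / ‖1 - (rotation : ℂ) ^ m‖) := by
  have hne : 1 - (rotation : ℂ) ^ m ≠ 0 := sub_ne_zero.2 (rotation_pow_ne_one hm).symm
  -- The fixed point of $\zeta\mapsto c_m+\rho^m\zeta$, the plane rotation that advances the drift
  -- by one period.
  set w : ℂ := drift m x / (1 - (rotation : ℂ) ^ m) with hw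
  have hwn : ‖w‖ ≤ m / ‖1 - (rotation : ℂ) ^ m‖ := by
    rw [hw, norm_div]
    gcongr
    exact norm_drift_le m x
  have hper : Function.Periodic (fun n => ‖drift n x - w‖) m := by
    intro n
    have h1 : drift (n + m) x - w = (rotation : ℂ) ^ m * (drift n x - w) := by
      rw [add_comm n m, drift_add, hx.eq]
      have : drift m x = w * (1 - (rotation : ℂ) ^ m) := by rw [hw, div_mul_cancel₀ _ hne]
      rw [this]
      ring
    simp only [h1, norm_mul, norm_pow, Circle.norm_coe, one_pow, one_mul]
  have h2 : ‖drift n x - w‖ ≤ m + ‖w‖ := by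
    -- The distance to the center is periodic in $n$, so only $n<m$ matters, where the trivial bound
    -- $n$ applies.
    rw [← hper.map_mod_nat n]
    refine (norm_sub_le _ _).trans ?_
    gcongr
    exact (norm_drift_le _ x).trans (by exact_mod_cast (Nat.mod_lt n hm).le)
  calc ‖drift n x‖ = ‖(drift n x - w) + w‖ := by rw [sub_add_cancel]
    _ ≤ ‖drift n x - w‖ + ‖w‖ := norm_add_le _ _
    _ ≤ m + 2 * (m / ‖1 - (rotation : ℂ) ^ m‖) := by linarith

/-! ### Integrability and exponents over periodic orbits -/

lemma continuous_symbolSign_apply (i : ℤ) :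
    Continuous fun x : FullShift 2 => symbolSign (x i) :=
  (continuous_of_discreteTopology (f := symbolSign)).comp (continuous_apply i)

lemma continuous_drift (n : ℕ) : Continuous (drift n) := by
  unfold drift
  refine continuous_finsetSum _ fun j _ => ?_
  exact (continuous_symbolSign_apply j).mul continuous_const

lemma measurable_log_fiberDerivNorm_cocycle (n : ℕ) :
    Measurable fun z => Real.log (fiberDerivNorm cocycle n z) := by
  simp only [fiberDerivNorm_cocycle]
  have h : Continuous fun z : FullShift 2 × M => ((drift n z.1, rotation ^ n), z.2) :=
    (((continuous_drift n).comp continuous_fst).prodMk continuous_const).prodMk continuous_snd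
  have h' := continuous_derivNorm_modelMap.comp h
  exact Real.measurable_log.comp h'.measurable

lemma integrable_log_fiberDerivNorm_cocycle (μ : Measure (FullShift 2 × M)) [IsFiniteMeasure μ]
    (n : ℕ) : Integrable (fun z => Real.log (fiberDerivNorm cocycle n z)) μ := by
  obtain ⟨L, hL⟩ := exists_abs_log_derivNorm_modelMap_le n
  refine Integrable.of_bound (measurable_log_fiberDerivNorm_cocycle n).aestronglyMeasurable L
    (.of_forall fun z => ?_)
  rw [fiberDerivNorm_cocycle]
  exact hL _ _ _ (norm_drift_le n z.1)

lemma tendsto_one_div_mul_zero_of_bounded {a : ℕ → ℝ} {L : ℝ} (h : ∀ n, |a n| ≤ L) :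
    Tendsto (fun n : ℕ => (1 / (n : ℝ)) * a n) atTop (𝓝 0) := by
  refine squeeze_zero_norm (a := fun n : ℕ => 1 / (n : ℝ) * L) (fun n => ?_) ?_
  · rw [norm_mul, Real.norm_eq_abs, Real.norm_eq_abs, abs_of_nonneg (by positivity)]
    gcongr
    exact h n
  · simpa using tendsto_one_div_atTop_nhds_zero_nat.mul_const L

lemma hasFiberExponentAt_cocycle_zero {B : ℝ} {z : FullShift 2 × M}
    (hz : ∀ n, ‖drift n z.1‖ ≤ B) {v : TangentSpace IM z.2} (hv : v ≠ 0) :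
    HasFiberExponentAt cocycle z v 0 := by
  obtain ⟨K, hK1, hK⟩ := exists_imageNorm_modelMap_bounds B
  have hv0 := tangentNorm_pos hv
  refine tendsto_one_div_mul_zero_of_bounded
    (L := Real.log K + |Real.log (tangentNorm z.2 v)|) fun n => ?_
  rw [tangentNorm_fiberDeriv_cocycle]
  obtain ⟨h1, h2⟩ := hK (drift n z.1) (rotation ^ n) z.2 v (hz n)
  have h3 := abs_log_le_of_bounds hK1 ((le_div_iff₀ hv0).2 h1) ((div_le_iff₀ hv0).2 h2)
  have h4 : 0 < imageNorm (modelMap (drift n z.1) (rotation ^ n)) z.2 v :=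
    lt_of_lt_of_le (by positivity) h1
  rw [Real.log_div h4.ne' hv0.ne'] at h3
  calc _ = |(Real.log (imageNorm (modelMap (drift n z.1) (rotation ^ n)) z.2 v) -
        Real.log (tangentNorm z.2 v)) + Real.log (tangentNorm z.2 v)| := by rw [sub_add_cancel]
    _ ≤ _ := (abs_add_le _ _).trans (by gcongr)

/-- Over periodic orbits of the shift all fiber exponents of the cocycle are zero. -/
lemma allFiberExponentsZero_cocycle (ν : Measure (FullShift 2 × M)) [IsProbabilityMeasure ν]
    (hν : SupportedOverPeriodicOrbit ν) : AllFiberExponentsZero cocycle ν := by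
  obtain ⟨x, ⟨m, hm, hx⟩, hsupp⟩ := hν
  have hB : ∀ᵐ z ∂ν, ∀ n, ‖drift n z.1‖ ≤ m + 2 * (m / ‖1 - (rotation : ℂ) ^ m‖) := by
    filter_upwards [hsupp] with z hz n
    obtain ⟨j, hj⟩ := hz
    rw [hj]
    exact norm_drift_le_of_isPeriodicPt hm (hx.apply_iterate j) n
  refine ⟨?_, integrable_log_fiberDerivNorm_cocycle ν, ?_⟩
  · filter_upwards [hB] with z hz v hv
    exact hasFiberExponentAt_cocycle_zero hz hv
  · obtain ⟨L, hL⟩ := exists_abs_log_derivNorm_modelMap_le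
      (m + 2 * (m / ‖1 - (rotation : ℂ) ^ m‖))
    refine tendsto_one_div_mul_zero_of_bounded (L := L) fun n => ?_
    have h : ∀ᵐ z ∂ν, ‖Real.log (fiberDerivNorm cocycle n z)‖ ≤ L := by
      filter_upwards [hB] with z hz
      rw [fiberDerivNorm_cocycle]
      exact hL _ _ _ (hz n)
    simpa using norm_integral_le_of_norm_le_const h

/-! ### The coded measure and its exponent -/

/-- The Borel σ-algebra of the circle. -/
abbrev circleMeasurableSpace : MeasurableSpace Circle := borel Circle

attribute [local instance] circleMeasurableSpace

lemma circle_borelSpace : BorelSpace Circle := ⟨rfl⟩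

attribute [local instance] circle_borelSpace

/-- The Haar probability measure of the circle. -/
abbrev circleHaar : Measure Circle :=
  Measure.haarMeasure (⊤ : TopologicalSpace.PositiveCompacts Circle)

lemma isProbabilityMeasure_circleHaar : IsProbabilityMeasure circleHaar :=
  ⟨by simpa using Measure.haarMeasure_self (K₀ := (⊤ : TopologicalSpace.PositiveCompacts Circle))⟩

attribute [local instance] isProbabilityMeasure_circleHaar

open Classical in
/-- The coding of the rotation orbit of a point of the circle by the right and left half-planes. -/
def itinerary (w : Circle) : FullShift 2 :=
  fun i => if 0 ≤ ((rotation ^ i * w : Circle) : ℂ).re then 0 else 1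

lemma itinerary_rotation_mul (w : Circle) : itinerary (rotation * w) = shift (itinerary w) := by
  funext i
  simp only [itinerary, shift, zpow_add_one, mul_assoc]

lemma measurable_itinerary : Measurable itinerary := by
  refine measurable_pi_lambda _ fun i => ?_
  refine Measurable.ite (IsClosed.measurableSet ?_) measurable_const measurable_const
  exact isClosed_le continuous_const (by fun_prop)

lemma symbolSign_itinerary_mul_re (w : Circle) (j : ℕ) :
    (symbolSign (itinerary w j) * (rotation : ℂ) ^ j * w).re =
      |((rotation ^ j * w : Circle) : ℂ).re| := by
  have h : ((rotation ^ (j : ℤ) * w : Circle) : ℂ) = (rotation : ℂ) ^ j * w := by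
    simp
  have h' : ((rotation ^ j * w : Circle) : ℂ) = (rotation : ℂ) ^ j * w := by simp
  rw [h', mul_assoc, itinerary, h, symbolSign]
  split_ifs with h1 h2 h2
  · rw [one_mul, abs_of_nonneg h1]
  · exact absurd rfl h2
  · exact absurd h2 (by decide)
  · rw [neg_one_mul, Complex.neg_re, abs_of_neg (not_le.1 h1)]

/-- The point of `Σ × S^3 × S^1` over the pole with circle coordinate `w` and its own itinerary. -/
def codedPoint (w : Circle) : FullShift 2 × M :=
  (itinerary w, (polePoint, ⟨planeIso w, by simp [Circle.norm_coe]⟩))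

lemma measurable_codedPoint : Measurable codedPoint := by
  refine measurable_itinerary.prodMk (measurable_const.prodMk (Continuous.measurable ?_))
  exact (planeIso.continuous.comp continuous_induced_dom).subtype_mk _

/-- The coding conjugates the circle rotation to the skew product on its image: the pole is fixed,
and rotating $w$ shifts its itinerary. Invariance of Haar measure therefore passes to its image. -/
lemma skewProduct_codedPoint (w : Circle) :
    skewProduct cocycle (codedPoint w) = codedPoint (rotation * w) := by
  refine Prod.ext (itinerary_rotation_mul w).symm ?_
  change modelMap _ _ (polePoint, _) = _
  rw [modelMap_polePoint]
  refine Prod.ext rfl (Subtype.ext ?_)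
  simp [modelMap, ambientMap, inclusion, codedPoint]

lemma continuous_modelMap : Continuous fun z : (ℂ × Circle) × M => modelMap z.1.1 z.1.2 z.2 := by
  have h : Continuous fun z : (ℂ × Circle) × M => ambientMap z.1.1 z.1.2 (inclusion z.2) := by
    refine continuous_iff_continuousAt.2 fun z => ?_
    refine (contDiffAt_ambientMap ((z.1.1, z.1.2), inclusion z.2)
      (inclusion_fst_ne_zero z.2)).continuousAt.comp
      (f := fun z : (ℂ × Circle) × M => ((z.1.1, (z.1.2 : ℂ)), inclusion z.2)) ?_
    have := continuous_inclusion
    fun_prop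
  exact (h.fst.subtype_mk _).prodMk (h.snd.subtype_mk _)

lemma measurable_skewProduct_cocycle : Measurable (skewProduct cocycle) := by
  refine Continuous.measurable (Continuous.prodMk ?_ ?_)
  · exact continuous_pi fun i => (continuous_apply (i + 1)).comp continuous_fst
  · have h : Continuous fun z : FullShift 2 × M => ((symbolSign (z.1 0), rotation), z.2) :=
      (((continuous_symbolSign_apply 0).comp continuous_fst).prodMk continuous_const).prodMk
        continuous_snd
    have h' := continuous_modelMap.comp h
    exact h'

/-- The image of the Haar measure of the circle under the coding. -/
def codedMeasure : Measure (FullShift 2 × M) := circleHaar.map codedPoint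

lemma isProbabilityMeasure_codedMeasure : IsProbabilityMeasure codedMeasure :=
  Measure.isProbabilityMeasure_map measurable_codedPoint.aemeasurable

lemma measurePreserving_codedMeasure :
    MeasurePreserving (skewProduct cocycle) codedMeasure codedMeasure := by
  refine ⟨measurable_skewProduct_cocycle, ?_⟩
  have h := measurePreserving_mul_left circleHaar rotation
  rw [codedMeasure, Measure.map_map measurable_skewProduct_cocycle measurable_codedPoint]
  have hs : skewProduct cocycle ∘ codedPoint = codedPoint ∘ fun w => rotation * w :=
    funext skewProduct_codedPoint
  rw [hs, ← Measure.map_map measurable_codedPoint h.measurable, h.map_eq]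

lemma log_fiberDerivNorm_codedPoint (n : ℕ) (w : Circle) :
    Real.log (fiberDerivNorm cocycle n (codedPoint w)) =
      ∑ j ∈ Finset.range n, |((rotation ^ j * w : Circle) : ℂ).re| := by
  have h : (drift n (itinerary w) * planeIso.symm (planeIso (w : ℂ))).re =
      ∑ j ∈ Finset.range n, |((rotation ^ j * w : Circle) : ℂ).re| := by
    rw [LinearIsometryEquiv.symm_apply_apply, drift, Finset.sum_mul, Complex.re_sum]
    exact Finset.sum_congr rfl fun j _ => symbolSign_itinerary_mul_re w j
  rw [fiberDerivNorm_cocycle]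
  refine (congrArg Real.log (derivNorm_modelMap_polePoint _ _ _ ?_)).trans ?_
  · exact h.symm ▸ Finset.sum_nonneg fun j _ => abs_nonneg _
  · rw [Real.log_exp]
    exact h

lemma integral_log_fiberDerivNorm_codedMeasure (n : ℕ) :
    ∫ z, Real.log (fiberDerivNorm cocycle n z) ∂codedMeasure =
      n * ∫ w : Circle, |(w : ℂ).re| ∂circleHaar := by
  rw [codedMeasure, integral_map measurable_codedPoint.aemeasurable
    (measurable_log_fiberDerivNorm_cocycle n).aestronglyMeasurable]
  simp only [log_fiberDerivNorm_codedPoint]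
  rw [integral_finsetSum]
  -- By rotation invariance every summand has the same integral.
  · simp only [fun j : ℕ => integral_mul_left_eq_self (μ := circleHaar)
      (fun w : Circle => |(w : ℂ).re|) (rotation ^ j)]
    simp
  · intro j _
    exact (Continuous.integrable_of_hasCompactSupport (by fun_prop)
      (HasCompactSupport.of_compactSpace _))

lemma integral_abs_re_pos : 0 < ∫ w : Circle, |(w : ℂ).re| ∂circleHaar :=
  Continuous.integral_pos_of_hasCompactSupport_nonneg_nonzero (x := 1) (by fun_prop)
    (HasCompactSupport.of_compactSpace _) (fun _ => abs_nonneg _) (by simp)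

lemma hasTopFiberExponent_codedMeasure :
    HasTopFiberExponent cocycle codedMeasure (∫ w : Circle, |(w : ℂ).re| ∂circleHaar) := by
  have := isProbabilityMeasure_codedMeasure
  refine ⟨integrable_log_fiberDerivNorm_cocycle codedMeasure, ?_⟩
  refine tendsto_const_nhds.congr' ?_
  filter_upwards [eventually_ne_atTop 0] with n hn
  rw [integral_log_fiberDerivNorm_codedMeasure]
  field_simp

end FiberLyapunov

end

theorem theorem1p7 :
    ∃ (k : ℕ) (A : FiberLyapunov.FullShift k → FiberLyapunov.DiffM),
      IsLocallyConstant A ∧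
      (∃ μ : Measure (FiberLyapunov.FullShift k × FiberLyapunov.M),
        IsProbabilityMeasure μ ∧
        MeasurePreserving (FiberLyapunov.skewProduct A) μ μ ∧
        ∃ c : ℝ, c ≠ 0 ∧ FiberLyapunov.HasTopFiberExponent A μ c) ∧
      ∀ ν : Measure (FiberLyapunov.FullShift k × FiberLyapunov.M),
        IsProbabilityMeasure ν →
        MeasurePreserving (FiberLyapunov.skewProduct A) ν ν →
        FiberLyapunov.SupportedOverPeriodicOrbit ν →
        FiberLyapunov.AllFiberExponentsZero A ν := by
  refine ⟨2, FiberLyapunov.cocycle, FiberLyapunov.isLocallyConstant_cocycle,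
    ⟨FiberLyapunov.codedMeasure, FiberLyapunov.isProbabilityMeasure_codedMeasure,
      FiberLyapunov.measurePreserving_codedMeasure, _,
      FiberLyapunov.integral_abs_re_pos.ne',
      FiberLyapunov.hasTopFiberExponent_codedMeasure⟩, ?_⟩
  intro ν _ _ hsupp
  exact FiberLyapunov.allFiberExponentsZero_cocycle ν hsupp
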